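/- For an open set $\Omega\subset\mathbb R^3$ let $V(\Omega)$ be the space of divergence-free vector fields in $C_c^\infty(\Omega;\mathbb R^3)$, let $\mathcal H(\Omega)$ be the closure of $V(\Omega)$ in $L^2(\Omega;\mathbb R^3)$, and let $\mathbb P_\Omega:L^2(\Omega;\mathbb R^3)\to\mathcal H(\Omega)$ be the orthogonal (Leray) projection. A smooth obstacle is a compact set $K\subset\mathbb R^3$ with $C^\infty$ boundary (locally lying on one side of it) such that $\mathbb R^3\setminus K$ is simply connected. Let $\mathcal C\subset\mathbb R^3$ be a compact injective $C^2$ curve, i.e. $\mathcal C=\gamma([a,b])$ with $a<b$ and $\gamma:[a,b]\to\mathbb R^3$ injective, of class $C^2$ and with $\gamma'\neq0$ on $[a,b]$. Let $(\mathcal C_n)_{n\in\mathbb N}$ be smooth obstacles with $\mathcal C\subset\mathcal C_n$ for every $n$, whose Hausdorff distance to $\mathcal C$ tends to $0$, and put $\Omega_n=\mathbb R^3\setminus\mathcal C_n$. Let $\omega_0\in V(\mathbb R^3)$ and let \[ v_0(x)=-\int_{\mathbb R^3}\frac{x-y}{4\pi|x-y|^3}\times\omega_0(y)\,dy . \] Then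 $v_0\in L^2(\mathbb R^3)$ and, with $u_0^n:=\mathbb P_{\Omega_n}(v_0|_{\Omega_n})$ and $E$ the extension by zero from $\Omega_n$ to $\mathbb R^3$, \[ Eu_0^n\longrightarrow v_0\quad\text{strongly in }L^2(\mathbb R^3)\quad\text{as }n\to\infty . \] -/

import Mathlib

open MeasureTheory Filter Topology Set
open scoped ContDiff ENNReal

noncomputable section

namespace ThinObstacle

/-- Euclidean three-space. -/
abbrev E3 : Type := EuclideanSpace ℝ (Fin 3)

/-- The cross product on Euclidean three-space. -/
def cross (u v : E3) : E3 :=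
  WithLp.toLp 2 (crossProduct (WithLp.ofLp u) (WithLp.ofLp v))

/-- The divergence of a vector field. -/
def divergence (φ : E3 → E3) (x : E3) : ℝ :=
  ∑ i : Fin 3, (fderiv ℝ φ x (EuclideanSpace.single i 1)) i

/-- `V(Ω)`: smooth divergence free vector fields with compact support contained in `Ω`. -/
structure IsTestField (Ω : Set E3) (φ : E3 → E3) : Prop where
  contDiff : ContDiff ℝ ∞ φ
  hasCompactSupport : HasCompactSupport φ
  tsupport_subset : tsupport φ ⊆ Ω
  divergence_eq_zero : ∀ x, divergence φ x = 0

lemma IsTestField.zero (Ω : Set E3) : IsTestField Ω (fun _ => 0) where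
  contDiff := contDiff_const
  hasCompactSupport := HasCompactSupport.zero
  tsupport_subset := by
    have h : tsupport (fun _ : E3 => (0 : E3)) = ∅ := tsupport_eq_empty_iff.2 rfl
    rw [h]
    exact empty_subset _
  divergence_eq_zero x := by simp [divergence]

lemma IsTestField.add {Ω : Set E3} {φ ψ : E3 → E3} (hφ : IsTestField Ω φ)
    (hψ : IsTestField Ω ψ) : IsTestField Ω (φ + ψ) where
  contDiff := hφ.contDiff.add hψ.contDiff
  hasCompactSupport := hφ.hasCompactSupport.add hψ.hasCompactSupport
  tsupport_subset :=
    (tsupport_add φ ψ).trans (union_subset hφ.tsupport_subset hψ.tsupport_subset)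
  divergence_eq_zero x := by
    have h1 := hφ.divergence_eq_zero x
    have h2 := hψ.divergence_eq_zero x
    have d1 : DifferentiableAt ℝ φ x := hφ.contDiff.differentiable (by simp) x
    have d2 : DifferentiableAt ℝ ψ x := hψ.contDiff.differentiable (by simp) x
    simp only [divergence] at *
    rw [fderiv_add d1 d2]
    simp [Finset.sum_add_distrib, h1, h2]

lemma IsTestField.smul {Ω : Set E3} {φ : E3 → E3} (c : ℝ) (hφ : IsTestField Ω φ) :
    IsTestField Ω (c • φ) where
  contDiff := hφ.contDiff.const_smul c
  hasCompactSupport := hφ.hasCompactSupport.smul_left (f := fun _ => c)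
  tsupport_subset :=
    (tsupport_smul_subset_right (fun _ : E3 => c) φ).trans hφ.tsupport_subset
  divergence_eq_zero x := by
    have h1 := hφ.divergence_eq_zero x
    have d1 : DifferentiableAt ℝ φ x := hφ.contDiff.differentiable (by simp) x
    simp only [divergence] at *
    rw [fderiv_const_smul d1 c]
    simp [← Finset.mul_sum, h1]

/-- `L²(Ω)`, for vector fields. -/
abbrev L2Field (Ω : Set E3) : Type := Lp E3 2 (volume.restrict Ω)

/-- The image of `V(Ω)` in `L²(Ω)`. -/
def testFieldsL2 (Ω : Set E3) : Submodule ℝ (L2Field Ω) where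
  carrier := {f | ∃ φ : E3 → E3, IsTestField Ω φ ∧ f =ᵐ[volume.restrict Ω] φ}
  zero_mem' := ⟨_, IsTestField.zero Ω, Lp.coeFn_zero E3 2 (volume.restrict Ω)⟩
  add_mem' := by
    rintro f g ⟨φ, hφ, hf⟩ ⟨ψ, hψ, hg⟩
    exact ⟨_, hφ.add hψ, (Lp.coeFn_add f g).trans (hf.add hg)⟩
  smul_mem' := by
    rintro c f ⟨φ, hφ, hf⟩
    exact ⟨_, hφ.smul c, (Lp.coeFn_smul c f).trans (hf.const_smul c)⟩

/-- `𝓗(Ω)`: the closure of `V(Ω)` in the `L²` norm. -/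
def solenoidal (Ω : Set E3) : Submodule ℝ (L2Field Ω) :=
  (testFieldsL2 Ω).topologicalClosure

instance (Ω : Set E3) : CompleteSpace (solenoidal Ω) :=
  (testFieldsL2 Ω).isClosed_topologicalClosure.completeSpace_coe

/-- The Leray projection: the orthogonal projection of `L²(Ω)` onto `𝓗(Ω)`. -/
def lerayProjection (Ω : Set E3) : L2Field Ω →L[ℝ] solenoidal Ω :=
  (solenoidal Ω).orthogonalProjectionOnto

/-- The restriction to `Ω` of a square integrable field on the whole space. -/
def restrictL2 (Ω : Set E3) {v : E3 → E3} (hv : MemLp v 2 volume) : L2Field Ω :=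
  (hv.restrict Ω).toLp v

/-- The extension by zero outside `Ω`. -/
def extendByZero (Ω : Set E3) (f : L2Field Ω) : E3 → E3 :=
  Ω.indicator f

/-- The Biot–Savart field of a vorticity in the whole space. -/
def biotSavart (w : E3 → E3) (x : E3) : E3 :=
  -∫ y, cross ((1 / (4 * Real.pi * ‖x - y‖ ^ 3)) • (x - y)) (w y)

/-- A compact injective curve of class `C²`: the image of a compact interval under an
injective regular parametrization of class `C²`. -/
def IsInjectiveC2Curve (C : Set E3) : Prop :=
  ∃ (a b : ℝ) (γ : ℝ → E3), a < b ∧ ContDiffOn ℝ 2 γ (Icc a b) ∧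
    (∀ t ∈ Icc a b, derivWithin γ (Icc a b) t ≠ 0) ∧
    InjOn γ (Icc a b) ∧ C = γ '' Icc a b

/-- The closed set `K` has a smooth boundary: near each boundary point it is a sublevel set of
a smooth function with nonvanishing differential. -/
def HasSmoothBoundary (K : Set E3) : Prop :=
  ∀ x ∈ frontier K, ∃ U ∈ 𝓝 x, ∃ f : E3 → ℝ,
    ContDiff ℝ ∞ f ∧ fderiv ℝ f x ≠ 0 ∧ ∀ y ∈ U, (y ∈ K ↔ f y ≤ 0)

/-- A smooth obstacle: a compact set with smooth boundary and simply connected complement. -/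
structure IsSmoothObstacle (K : Set E3) : Prop where
  isCompact : IsCompact K
  isSimplyConnected_compl : IsSimplyConnected Kᶜ
  hasSmoothBoundary : HasSmoothBoundary K

end ThinObstacle

end

/-!
The Biot–Savart field `v₀` is the curl of the Newtonian potential `ψ` of the vorticity. The tubes of
radius `r` around a curve have volume `O(r ^ 2)`, so cutting `ψ` off at distance `r` from the curve,
with gradients of size `1 / r`, changes `curl ψ` by an amount that is bounded in `L²` and vanishes
at each point off the curve once `r` is small. The same holds for cutoffs at a large radius `R`,
because `|ψ(x)| = O(1 / |x|)` at infinity. The curls of the cut-off potentials therefore converge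
weakly to `v₀`, and since closed subspaces are weakly closed, `v₀` lies in the closure of the test
fields supported off the curve. A test field close to `v₀` and supported off the curve is admissible
for all obstacles close enough to the curve, and the Leray projection of `v₀` is at least as close
to `v₀` as that test field.
-/

noncomputable section

namespace ThinObstacle

open scoped Convolution

section Cutoff

variable {E : Type*} [NormedAddCommGroup E] [NormedSpace ℝ E]

/-- `η` is a smooth cutoff around `S` at scale `r`: it equals `1` on the `r`-thickening of `S`,
vanishes off the `3r`-thickening, and `M / r` bounds its gradient. -/
structure IsCutoff (S : Set E) (r M : ℝ) (η : E → ℝ) : Prop where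
  contDiff : ContDiff ℝ ∞ η
  nonneg : ∀ x, 0 ≤ η x
  le_one : ∀ x, η x ≤ 1
  eq_one_of_mem : ∀ x ∈ Metric.thickening r S, η x = 1
  eq_zero_of_notMem : ∀ x ∉ Metric.thickening (3 * r) S, η x = 0
  norm_fderiv_le : ∀ x, ‖fderiv ℝ η x‖ ≤ M / r

variable {S : Set E} {r M : ℝ} {η : E → ℝ}

lemma IsCutoff.fderiv_eq_zero_of_mem (hη : IsCutoff S r M η) {x : E}
    (hx : x ∈ Metric.thickening r S) : fderiv ℝ η x = 0 :=
  IsLocalMax.fderiv_eq_zero (Eventually.of_forall fun y =>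
    (hη.le_one y).trans (hη.eq_one_of_mem x hx).ge)

lemma IsCutoff.fderiv_eq_zero_of_notMem (hη : IsCutoff S r M η) {x : E}
    (hx : x ∉ Metric.thickening (3 * r) S) : fderiv ℝ η x = 0 :=
  IsLocalMin.fderiv_eq_zero (Eventually.of_forall fun y =>
    (hη.eq_zero_of_notMem x hx).le.trans (hη.nonneg y))

lemma IsCutoff.tsupport_one_sub_subset (hη : IsCutoff S r M η) :
    tsupport (fun x => 1 - η x) ⊆ (Metric.thickening r S)ᶜ :=
  closure_minimal (fun x hx hxS => hx (sub_eq_zero.2 (hη.eq_one_of_mem x hxS).symm))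
    Metric.isOpen_thickening.isClosed_compl

lemma IsCutoff.hasCompactSupport [ProperSpace E] (hη : IsCutoff S r M η)
    (hS : Bornology.IsBounded S) : HasCompactSupport η :=
  HasCompactSupport.of_support_subset_isCompact hS.thickening.isCompact_closure
    (fun x hx => subset_closure (not_imp_comm.1 (hη.eq_zero_of_notMem x) hx))

lemma IsCutoff.comp_inv_smul {T : Set E} (hr : 0 < r)
    (hη : IsCutoff ((fun z => r • z) ⁻¹' T) 1 M η) : IsCutoff T r M fun x => η (r⁻¹ • x) := by
  have mem_iff : ∀ (ρ : ℝ) (x : E), r⁻¹ • x ∈ Metric.thickening ρ ((fun z => r • z) ⁻¹' T) ↔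
      x ∈ Metric.thickening (ρ * r) T := by
    intro ρ x
    have dist_lt : ∀ z, dist (r⁻¹ • x) z < ρ ↔ dist x (r • z) < ρ * r := fun z => by
      rw [← inv_smul_smul₀ hr.ne' z, dist_smul₀, smul_inv_smul₀ hr.ne', norm_inv,
        Real.norm_of_nonneg hr.le, inv_mul_lt_iff₀ hr, mul_comm]
    simp only [Metric.mem_thickening_iff, dist_lt, mem_preimage]
    exact ⟨fun ⟨z, hz, h⟩ => ⟨_, hz, h⟩, fun ⟨y, hy, h⟩ =>
      ⟨r⁻¹ • y, by rwa [smul_inv_smul₀ hr.ne'], by rwa [smul_inv_smul₀ hr.ne']⟩⟩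
  refine ⟨hη.contDiff.comp (contDiff_const_smul _), fun x => hη.nonneg _, fun x => hη.le_one _,
    fun x hx => hη.eq_one_of_mem _ ((mem_iff 1 x).2 (by rwa [one_mul])),
    fun x hx => hη.eq_zero_of_notMem _
      fun h => hx (by simpa only [mul_one] using (mem_iff _ x).1 h),
    fun x => ?_⟩
  rw [fderiv_comp_smul, norm_smul, norm_inv, Real.norm_of_nonneg hr.le, div_eq_inv_mul]
  gcongr
  simpa only [div_one] using hη.norm_fderiv_le (r⁻¹ • x)

end Cutoff

section Convolution

variable {E F F' G : Type*} [NormedAddCommGroup E] [MeasurableSpace E]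
  [NormedAddCommGroup F] [NormedSpace ℝ F] [NormedAddCommGroup F'] [NormedSpace ℝ F']
  [NormedAddCommGroup G] [NormedSpace ℝ G]

lemma norm_convolution_le_of_norm_le {μ : Measure E} (L : F →L[ℝ] F' →L[ℝ] G) {f : E → F}
    {g : E → F'} (hf : Integrable f μ) {c : ℝ} (hg : ∀ x, ‖g x‖ ≤ c) (x : E) :
    ‖(f ⋆[L, μ] g) x‖ ≤ ‖L‖ * c * ∫ t, ‖f t‖ ∂μ := by
  rw [← integral_const_mul]
  refine norm_integral_le_of_norm_le (hf.norm.const_mul _) (ae_of_all _ fun t => ?_)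
  calc ‖L (f t) (g (x - t))‖ ≤ ‖L‖ * ‖f t‖ * ‖g (x - t)‖ := L.le_opNorm₂ _ _
    _ ≤ ‖L‖ * ‖f t‖ * c := by gcongr; exact hg _
    _ = ‖L‖ * c * ‖f t‖ := by ring

end Convolution

section ExistsCutoff

variable (E : Type*) [NormedAddCommGroup E] [NormedSpace ℝ E] [FiniteDimensional ℝ E]

set_option maxSynthPendingDepth 3 in
lemma exists_isCutoff_unit_scale : ∃ M, 0 ≤ M ∧ ∀ S : Set E, ∃ η, IsCutoff S 1 M η := by
  borelize E
  let μ : Measure E := Measure.addHaar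
  let bump : ContDiffBump (0 : E) := ⟨1 / 2, 1, by norm_num, by norm_num⟩
  let ρ : E → ℝ := bump.normed μ
  have hρ : ContDiff ℝ ∞ ρ := bump.contDiff_normed
  have hρc : HasCompactSupport ρ := bump.hasCompactSupport_normed
  let L : ℝ →L[ℝ] ℝ →L[ℝ] ℝ := ContinuousLinearMap.lsmul ℝ ℝ
  refine ⟨‖L.precompL E‖ * 1 * ∫ t, ‖fderiv ℝ ρ t‖ ∂μ, by positivity, fun S => ?_⟩
  let g : E → ℝ := (Metric.thickening (1 + 1) S).indicator 1
  have three_eq : (1 + (1 + 1) : ℝ) = 3 * 1 := by norm_num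
  have g_nonneg : ∀ x, 0 ≤ g x := indicator_nonneg fun _ _ => zero_le_one
  have g_le_one : ∀ x, g x ≤ 1 := indicator_le_self' fun _ _ => zero_le_one
  have hg : LocallyIntegrable g μ :=
    (locallyIntegrable_const 1).indicator Metric.isOpen_thickening.measurableSet
  have eq_on_ball : ∀ x, (∀ y ∈ Metric.ball x 1, g y = g x) → (ρ ⋆[L, μ] g) x = g x :=
    fun x => bump.normed_convolution_eq_right
  refine ⟨ρ ⋆[L, μ] g, hρc.contDiff_convolution_left L hρ hg,
    fun x => integral_nonneg fun t => mul_nonneg (bump.nonneg_normed t) (g_nonneg _),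
    fun x => ?_, fun x hx => ?_, fun x hx => ?_, fun x => ?_⟩
  · rw [← bump.integral_normed (μ := μ)]
    exact integral_mono_of_nonneg
      (ae_of_all _ fun t => mul_nonneg (bump.nonneg_normed t) (g_nonneg _)) bump.integrable_normed
      (ae_of_all _ fun t => mul_le_of_le_one_right (bump.nonneg_normed t) (g_le_one _))
  · have g_eq_one : ∀ y ∈ Metric.ball x 1, g y = 1 := fun y hy => indicator_of_mem
      (Metric.thickening_thickening_subset 1 1 S (Metric.ball_subset_thickening hx 1 hy)) _
    have hx1 := g_eq_one x (Metric.mem_ball_self one_pos)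
    rw [eq_on_ball x fun y hy => (g_eq_one y hy).trans hx1.symm, hx1]
  · have g_eq_zero : ∀ y ∈ Metric.ball x 1, g y = 0 := fun y hy => indicator_of_notMem
      (fun h => hx (three_eq ▸ Metric.thickening_thickening_subset 1 (1 + 1) S
        (Metric.ball_subset_thickening h 1 (Metric.mem_ball_comm.1 hy)))) _
    have hx0 := g_eq_zero x (Metric.mem_ball_self one_pos)
    rw [eq_on_ball x fun y hy => (g_eq_zero y hy).trans hx0.symm, hx0]
  · rw [(hρc.hasFDerivAt_convolution_left L (hρ.of_le (by simp)) hg x).fderiv, div_one]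
    exact norm_convolution_le_of_norm_le _
      ((hρ.continuous_fderiv (by simp)).integrable_of_hasCompactSupport (hρc.fderiv ℝ))
      (fun y => (Real.norm_of_nonneg (g_nonneg y)).trans_le (g_le_one y)) x

lemma exists_isCutoff :
    ∃ M, 0 ≤ M ∧ ∀ (S : Set E) {r : ℝ}, 0 < r → ∃ η, IsCutoff S r M η := by
  obtain ⟨M, hM, exists_unit⟩ := exists_isCutoff_unit_scale E
  refine ⟨M, hM, fun S r hr => ?_⟩
  obtain ⟨η, hη⟩ := exists_unit ((fun z => r • z) ⁻¹' S)
  exact ⟨_, hη.comp_inv_smul hr⟩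

end ExistsCutoff

section SingularKernel

variable {E : Type*} [NormedAddCommGroup E] [NormedSpace ℝ E]

lemma IsCutoff.norm_fderiv_le_inv_norm {r M : ℝ} {η : E → ℝ} (hη : IsCutoff {0} r M η)
    (hM : 0 ≤ M) (z : E) : ‖fderiv ℝ η z‖ ≤ 3 * M * ‖z‖⁻¹ := by
  by_cases hz : z ∈ Metric.thickening (3 * r) {0}
  · rw [Metric.thickening_singleton, mem_ball_zero_iff] at hz
    have hr : 0 < r := by linarith [norm_nonneg z]
    rcases eq_or_ne z 0 with rfl | hz0
    · rw [hη.fderiv_eq_zero_of_mem (Metric.self_subset_thickening hr _ rfl)]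
      simp
    · refine (hη.norm_fderiv_le z).trans ?_
      rw [← div_eq_mul_inv, div_le_div_iff₀ hr (norm_pos_iff.2 hz0)]
      nlinarith
  · rw [hη.fderiv_eq_zero_of_notMem hz, norm_zero]
    positivity

variable {F : Type*} [NormedAddCommGroup F] [NormedSpace ℝ F]

lemma eventually_eq_zero_of_isCutoff_zero {M : ℝ} {η : ℝ → E → ℝ}
    (hη : ∀ r > 0, IsCutoff {0} r M (η r)) {z : E} (hz : z ≠ 0) :
    ∀ᶠ r in 𝓝[>] (0 : ℝ), η r z = 0 ∧ fderiv ℝ (η r) z = 0 := by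
  have hz' : 0 < ‖z‖ / 3 := by positivity
  filter_upwards [Ioo_mem_nhdsGT hz'] with r hr
  have hzr : z ∉ Metric.thickening (3 * r) {0} := by
    rw [Metric.thickening_singleton, mem_ball_zero_iff]
    linarith [hr.2]
  exact ⟨(hη r hr.1).eq_zero_of_notMem z hzr, (hη r hr.1).fderiv_eq_zero_of_notMem hzr⟩

lemma fderiv_one_sub_smul_apply {η : E → ℝ} {g : E → F} {z : E} (hη : DifferentiableAt ℝ η z)
    (hg : DifferentiableAt ℝ g z) (v : E) : fderiv ℝ (fun z => (1 - η z) • g z) z v =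
      (1 - η z) • fderiv ℝ g z v - fderiv ℝ η z v • g z := by
  rw [fderiv_fun_smul (hη.const_sub 1) hg, fderiv_const_sub]
  simp [sub_eq_add_neg]

variable [MeasurableSpace E] [BorelSpace E] {μ : Measure E}

section ShrinkingCutoff

variable [NullSingletonClass μ] {M : ℝ} {η : ℝ → E → ℝ}

lemma tendsto_integral_one_sub_cutoff_smul (hη : ∀ r > 0, IsCutoff {0} r M (η r)) {f : E → F}
    (hf : Integrable f μ) :
    Tendsto (fun r => ∫ z, (1 - η r z) • f z ∂μ) (𝓝[>] 0) (𝓝 (∫ z, f z ∂μ)) := by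
  refine tendsto_integral_filter_of_dominated_convergence (fun z => ‖f z‖) ?_ ?_ hf.norm ?_
  · filter_upwards [self_mem_nhdsWithin] with r hr
    exact (continuous_const.sub (hη r hr).contDiff.continuous).aestronglyMeasurable.smul
      hf.aestronglyMeasurable
  · filter_upwards [self_mem_nhdsWithin] with r hr
    refine ae_of_all _ fun z => ?_
    rw [norm_smul, Real.norm_of_nonneg (sub_nonneg.2 ((hη r hr).le_one z))]
    exact mul_le_of_le_one_left (norm_nonneg _) (sub_le_self _ ((hη r hr).nonneg z))
  · filter_upwards [compl_mem_ae_iff.2 (measure_singleton (0 : E))] with z hz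
    refine tendsto_nhds_of_eventually_eq ?_
    filter_upwards [eventually_eq_zero_of_isCutoff_zero hη hz] with r hr
    rw [hr.1, sub_zero, one_smul]

lemma tendsto_integral_fderiv_cutoff_smul (hη : ∀ r > 0, IsCutoff {0} r M (η r)) (hM : 0 ≤ M)
    (v : E) {f : E → F} (hfm : AEStronglyMeasurable f μ)
    (hf : Integrable (fun z => ‖z‖⁻¹ • f z) μ) :
    Tendsto (fun r => ∫ z, fderiv ℝ (η r) z v • f z ∂μ) (𝓝[>] 0) (𝓝 0) := by
  rw [← integral_zero E F (μ := μ)]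
  refine tendsto_integral_filter_of_dominated_convergence
    (fun z => 3 * M * ‖v‖ * ‖‖z‖⁻¹ • f z‖) ?_ ?_ (hf.norm.const_mul _) ?_
  · filter_upwards [self_mem_nhdsWithin] with r hr
    exact ((hη r hr).contDiff.continuous_fderiv (by simp)).clm_apply continuous_const
      |>.aestronglyMeasurable.smul hfm
  · filter_upwards [self_mem_nhdsWithin] with r hr
    refine ae_of_all _ fun z => ?_
    calc ‖fderiv ℝ (η r) z v • f z‖ ≤ ‖fderiv ℝ (η r) z‖ * ‖v‖ * ‖f z‖ := by
          rw [norm_smul]; gcongr; exact ContinuousLinearMap.le_opNorm _ _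
      _ ≤ 3 * M * ‖z‖⁻¹ * ‖v‖ * ‖f z‖ := by
          gcongr; exact (hη r hr).norm_fderiv_le_inv_norm hM z
      _ = 3 * M * ‖v‖ * ‖‖z‖⁻¹ • f z‖ := by rw [norm_smul, norm_inv, norm_norm]; ring
  · filter_upwards [compl_mem_ae_iff.2 (measure_singleton (0 : E))] with z hz
    refine tendsto_nhds_of_eventually_eq ?_
    filter_upwards [eventually_eq_zero_of_isCutoff_zero hη hz] with r hr
    rw [hr.2, zero_apply, zero_smul]

end ShrinkingCutoff

variable [FiniteDimensional ℝ E] {k : E → ℝ} {v : E}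

lemma locallyIntegrable_of_inv_norm_mul [NullSingletonClass μ]
    (hsing : LocallyIntegrable (fun z => ‖z‖⁻¹ * k z) μ) : LocallyIntegrable k μ := by
  refine (hsing.continuous_smul continuous_norm).congr ?_
  filter_upwards [compl_mem_ae_iff.2 (measure_singleton (0 : E))] with z hz
  exact mul_inv_cancel_left₀ (norm_ne_zero_iff.2 hz) _

variable [μ.IsAddHaarMeasure]

lemma integral_smul_fderiv_eq_neg_of_zero_notMem_tsupport
    (hk : ∀ z ≠ 0, DifferentiableAt ℝ k z) (hki : LocallyIntegrable k μ)
    (hk' : LocallyIntegrable (fun z => fderiv ℝ k z v) μ)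
    {g : E → F} (hg : ContDiff ℝ 1 g) (hc : HasCompactSupport g) (h0 : 0 ∉ tsupport g) :
    ∫ z, k z • fderiv ℝ g z v ∂μ = -∫ z, fderiv ℝ k z v • g z ∂μ :=
  integral_smul_fderiv_eq_neg_fderiv_smul_of_integrable
    (hk'.integrable_smul_right_of_hasCompactSupport hg.continuous hc)
    (hki.integrable_smul_right_of_hasCompactSupport
      ((hg.continuous_fderiv one_ne_zero).clm_apply continuous_const) (hc.fderiv_apply ℝ v))
    (hki.integrable_smul_right_of_hasCompactSupport hg.continuous hc)
    (fun z hz => hk z (ne_of_mem_of_not_mem hz h0))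
    (fun z _ => hg.differentiable one_ne_zero z)

lemma integral_one_sub_cutoff_smul_fderiv {r M : ℝ} (hr : 0 < r) {η : E → ℝ}
    (hη : IsCutoff {0} r M η) (hk : ∀ z ≠ 0, DifferentiableAt ℝ k z)
    (hki : LocallyIntegrable k μ) (hk' : LocallyIntegrable (fun z => fderiv ℝ k z v) μ)
    {g : E → F} (hg : ContDiff ℝ 1 g) (hc : HasCompactSupport g) :
    ∫ z, (1 - η z) • k z • fderiv ℝ g z v ∂μ - ∫ z, fderiv ℝ η z v • k z • g z ∂μ =
      -∫ z, (1 - η z) • fderiv ℝ k z v • g z ∂μ := by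
  have hη1 : ContDiff ℝ 1 η := hη.contDiff.of_le (by simp)
  have hη' : Continuous fun z => fderiv ℝ η z v :=
    (hη1.continuous_fderiv one_ne_zero).clm_apply continuous_const
  have hg' : Continuous fun z => fderiv ℝ g z v :=
    (hg.continuous_fderiv one_ne_zero).clm_apply continuous_const
  have zero_notMem : (0 : E) ∉ tsupport fun z => (1 - η z) • g z := fun h =>
    hη.tsupport_one_sub_subset (tsupport_smul_subset_left _ _ h)
      (Metric.self_subset_thickening hr _ rfl)
  have by_parts := integral_smul_fderiv_eq_neg_of_zero_notMem_tsupport hk hki hk'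
    (g := fun z => (1 - η z) • g z) ((contDiff_const.sub hη1).smul hg) hc.smul_left zero_notMem
  have cut_deriv := fun z => fderiv_one_sub_smul_apply (hη1.differentiable one_ne_zero z)
    (hg.differentiable one_ne_zero z) v
  have integrable_main : Integrable (fun z => k z • (1 - η z) • fderiv ℝ g z v) μ :=
    hki.integrable_smul_right_of_hasCompactSupport
      ((continuous_const.sub hη1.continuous).smul hg') (hc.fderiv_apply ℝ v).smul_left
  have integrable_error : Integrable (fun z => k z • fderiv ℝ η z v • g z) μ :=
    hki.integrable_smul_right_of_hasCompactSupport (hη'.smul hg.continuous) hc.smul_left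
  simp only [cut_deriv, smul_sub] at by_parts
  rw [integral_sub integrable_main integrable_error] at by_parts
  simpa only [smul_comm (k _), smul_comm (fderiv ℝ k _ v)] using by_parts

-- Multiplying `g` by `1 - η` for cutoffs `η` shrinking to the origin makes it vanish there. The
-- error is controlled because the gradient of `η` is at most a constant times `1 / ‖z‖`.
theorem integral_smul_fderiv_eq_neg_of_singularity [Nontrivial E]
    (hk : ∀ z ≠ 0, DifferentiableAt ℝ k z)
    (hsing : LocallyIntegrable (fun z => ‖z‖⁻¹ * k z) μ)
    (hk' : LocallyIntegrable (fun z => fderiv ℝ k z v) μ)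
    {g : E → F} (hg : ContDiff ℝ 1 g) (hc : HasCompactSupport g) :
    ∫ z, k z • fderiv ℝ g z v ∂μ = -∫ z, fderiv ℝ k z v • g z ∂μ := by
  have hki := locallyIntegrable_of_inv_norm_mul hsing
  obtain ⟨M, hM, exists_cutoff⟩ := exists_isCutoff E
  choose! η hη using fun r (hr : 0 < r) => exists_cutoff {0} hr
  have main_limit := tendsto_integral_one_sub_cutoff_smul hη
    (hki.integrable_smul_right_of_hasCompactSupport
      ((hg.continuous_fderiv one_ne_zero).clm_apply continuous_const) (hc.fderiv_apply ℝ v))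
  have hsing_g : Integrable (fun z => ‖z‖⁻¹ • k z • g z) μ := by
    simpa only [mul_smul] using hsing.integrable_smul_right_of_hasCompactSupport hg.continuous hc
  have error_limit := tendsto_integral_fderiv_cutoff_smul hη hM v
    (hki.aestronglyMeasurable.smul hg.continuous.aestronglyMeasurable) hsing_g
  have right_limit := (tendsto_integral_one_sub_cutoff_smul hη
    (hk'.integrable_smul_right_of_hasCompactSupport hg.continuous hc)).neg
  rw [← sub_zero (∫ z, k z • fderiv ℝ g z v ∂μ)]
  refine tendsto_nhds_unique (main_limit.sub error_limit) (right_limit.congr' ?_)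
  filter_upwards [self_mem_nhdsWithin] with r hr
  exact (integral_one_sub_cutoff_smul_fderiv hr (hη r hr) hk hki hk' hg hc).symm

theorem fderiv_convolution_of_singularity [Nontrivial E] {k' : E → E →L[ℝ] ℝ}
    (hk : ∀ z ≠ 0, HasFDerivAt k (k' z) z)
    (hsing : LocallyIntegrable (fun z => ‖z‖⁻¹ * k z) μ)
    (hk' : LocallyIntegrable (fun z => k' z v) μ)
    {w : E → F} (hw : ContDiff ℝ 1 w) (hc : HasCompactSupport w) (x : E) :
    fderiv ℝ (k ⋆[ContinuousLinearMap.lsmul ℝ ℝ, μ] w) x v =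
      ((fun z => k' z v) ⋆[ContinuousLinearMap.lsmul ℝ ℝ, μ] w) x := by
  have hg : ContDiff ℝ 1 fun z => w (x - z) := hw.comp (contDiff_const.sub contDiff_id)
  have hgc : HasCompactSupport fun z => w (x - z) := hc.comp_homeomorph (Homeomorph.subLeft x)
  have fderiv_reflect : ∀ z, fderiv ℝ (fun z => w (x - z)) z v = -fderiv ℝ w (x - z) v := by
    intro z
    have h : HasFDerivAt (fun z => w (x - z))
        ((fderiv ℝ w (x - z)).comp (-ContinuousLinearMap.id ℝ E)) z :=
      (hw.differentiable one_ne_zero (x - z)).hasFDerivAt.comp z ((hasFDerivAt_id z).const_sub x)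
    rw [h.fderiv]
    simp
  have hki := locallyIntegrable_of_inv_norm_mul hsing
  have fderiv_k_ae : (fun z => k' z v) =ᵐ[μ] fun z => fderiv ℝ k z v := by
    filter_upwards [compl_mem_ae_iff.2 (measure_singleton (0 : E))] with z hz
    rw [(hk z hz).fderiv]
  have by_parts := integral_smul_fderiv_eq_neg_of_singularity
    (fun z hz => (hk z hz).differentiableAt) hsing (hk'.congr fderiv_k_ae) hg hgc
  simp only [fderiv_reflect, smul_neg, integral_neg, neg_inj] at by_parts
  rw [(hc.hasFDerivAt_convolution_right _ hki hw x).fderiv,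
    convolution_precompR_apply _ hki (hc.fderiv ℝ) (hw.continuous_fderiv one_ne_zero),
    convolution_lsmul, convolution_lsmul, by_parts]
  refine integral_congr_ae ?_
  filter_upwards [fderiv_k_ae] with z hz
  rw [hz]

end SingularKernel

section Curl

/-- The cross product as a continuous bilinear map, for use in convolutions and derivatives. -/
def crossL : E3 →L[ℝ] E3 →L[ℝ] E3 :=
  (LinearMap.mk₂ ℝ cross
    (fun u v w => by simp [cross])
    (fun c u w => by simp [cross])
    (fun u v w => by simp [cross])
    (fun c u w => by simp [cross])).toContinuousBilinearMap

lemma crossL_apply (u v : E3) : crossL u v = cross u v := rfl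

/-- The curl of a vector field, written invariantly as the sum of `eᵢ × ∂ᵢψ`. -/
def curl (ψ : E3 → E3) (x : E3) : E3 :=
  ∑ i : Fin 3, crossL (EuclideanSpace.single i 1) (fderiv ℝ ψ x (EuclideanSpace.single i 1))

lemma sum_inner_single_smul_crossL (u v : E3) :
    ∑ i : Fin 3, inner ℝ u (EuclideanSpace.single i 1) • crossL (EuclideanSpace.single i 1) v =
      crossL u v := by
  conv_rhs => rw [← (EuclideanSpace.basisFun (Fin 3) ℝ).sum_repr' u]
  simp only [EuclideanSpace.basisFun_apply, real_inner_comm u, map_sum, map_smul, sum_apply,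
    smul_apply]

variable {ψ : E3 → E3}

lemma contDiff_curl (hψ : ContDiff ℝ ∞ ψ) : ContDiff ℝ ∞ (curl ψ) :=
  ContDiff.sum fun _ _ => (crossL _).contDiff.comp
    ((hψ.fderiv_right (by simp)).clm_apply contDiff_const)

lemma fderiv_curl_apply (hψ : ContDiff ℝ ∞ ψ) (x v : E3) :
    fderiv ℝ (curl ψ) x v = ∑ i : Fin 3, crossL (EuclideanSpace.single i 1)
      (fderiv ℝ (fderiv ℝ ψ) x v (EuclideanSpace.single i 1)) := by
  have hψ' : DifferentiableAt ℝ (fderiv ℝ ψ) x :=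
    (hψ.fderiv_right (m := ∞) (by simp)).differentiable (by simp) x
  have hasFDerivAt_curl := HasFDerivAt.fun_sum (u := Finset.univ) fun (i : Fin 3) _ =>
    (crossL (EuclideanSpace.single i 1)).hasFDerivAt.comp x
      (hψ'.hasFDerivAt.clm_apply (hasFDerivAt_const (EuclideanSpace.single i (1 : ℝ)) x))
  have fderiv_eq : fderiv ℝ (curl ψ) x = _ := hasFDerivAt_curl.fderiv
  rw [fderiv_eq]
  simp

lemma divergence_curl (hψ : ContDiff ℝ ∞ ψ) (x : E3) : divergence (curl ψ) x = 0 := by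
  have symm : IsSymmSndFDerivAt ℝ ψ x := hψ.contDiffAt.isSymmSndFDerivAt
    (by rw [minSmoothness_of_isRCLikeNormedField]; exact WithTop.coe_le_coe.2 le_top)
  have h01 := symm (EuclideanSpace.single 0 1) (EuclideanSpace.single 1 1)
  have h02 := symm (EuclideanSpace.single 0 1) (EuclideanSpace.single 2 1)
  have h12 := symm (EuclideanSpace.single 1 1) (EuclideanSpace.single 2 1)
  simp only [divergence, fderiv_curl_apply hψ, Fin.sum_univ_three, crossL_apply, cross]
  simp [crossProduct, h01, h02, h12]
  ring

lemma tsupport_curl_subset (ψ : E3 → E3) : tsupport (curl ψ) ⊆ tsupport ψ := by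
  refine closure_minimal (fun x hx => ?_) (isClosed_tsupport ψ)
  contrapose! hx
  simp [curl, Function.notMem_support.1 (mt (support_fderiv_subset ℝ ·) hx)]

lemma isTestField_curl {Ω : Set E3} (hψ : ContDiff ℝ ∞ ψ) (hc : HasCompactSupport ψ)
    (hs : tsupport ψ ⊆ Ω) : IsTestField Ω (curl ψ) where
  contDiff := contDiff_curl hψ
  hasCompactSupport := hc.mono' (subset_closure.trans (tsupport_curl_subset ψ))
  tsupport_subset := (tsupport_curl_subset ψ).trans hs
  divergence_eq_zero := divergence_curl hψ

lemma curl_smul {θ : E3 → ℝ} {x : E3} (hθ : DifferentiableAt ℝ θ x)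
    (hψ : DifferentiableAt ℝ ψ x) :
    curl (fun y => θ y • ψ y) x = θ x • curl ψ x + crossL (gradient θ x) (ψ x) := by
  rw [← sum_inner_single_smul_crossL]
  simp only [curl, fderiv_fun_smul hθ hψ, inner_gradient_left, Finset.smul_sum,
    ← Finset.sum_add_distrib]
  simp

lemma norm_gradient {H : Type*} [NormedAddCommGroup H] [InnerProductSpace ℝ H] [CompleteSpace H]
    (θ : H → ℝ) (x : H) : ‖gradient θ x‖ = ‖fderiv ℝ θ x‖ :=
  LinearIsometryEquiv.norm_map _ _

end Curl

section Decay

open Bornology Asymptotics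

variable {E F F' G : Type*} [NormedAddCommGroup E] [MeasurableSpace E] [BorelSpace E]
  [NormedAddCommGroup F] [NormedSpace ℝ F] [NormedAddCommGroup F'] [NormedSpace ℝ F']
  [NormedAddCommGroup G] [NormedSpace ℝ G] {μ : Measure E} [μ.IsAddLeftInvariant]
  [μ.IsNegInvariant]

theorem isBigO_cobounded_convolution (L : F →L[ℝ] F' →L[ℝ] G) {k : E → F} {c : ℝ} {m : ℕ}
    (hk : ∀ z, ‖k z‖ ≤ c * (‖z‖ ^ m)⁻¹) {w : E → F'} (hw : Integrable w μ)
    (hs : IsBounded (Function.support w)) :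
    (k ⋆[L, μ] w) =O[cobounded E] fun x => (‖x‖ ^ m)⁻¹ := by
  obtain ⟨R, hR, norm_le_R⟩ := hs.exists_pos_norm_le
  refine IsBigO.of_bound (‖L‖ * (|c| * 2 ^ m) * ∫ y, ‖w y‖ ∂μ) ?_
  filter_upwards [eventually_cobounded_le_norm (2 * R)] with x hx
  have hx0 : 0 < ‖x‖ := by linarith
  have norm_integrand_le : ∀ t, ‖L (k t) (w (x - t))‖ ≤
      ‖L‖ * (|c| * 2 ^ m) * (‖x‖ ^ m)⁻¹ * ‖w (x - t)‖ := by
    intro t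
    refine (L.le_opNorm₂ _ _).trans ?_
    rcases eq_or_ne (w (x - t)) 0 with hw0 | hw0
    · simp [hw0]
    have half_norm_le : ‖x‖ / 2 ≤ ‖t‖ := by
      linarith [norm_le_R _ hw0, norm_sub_norm_le x t]
    calc ‖L‖ * ‖k t‖ * ‖w (x - t)‖ ≤ ‖L‖ * (|c| * ((‖x‖ / 2) ^ m)⁻¹) * ‖w (x - t)‖ := by
          gcongr
          refine (hk t).trans ?_
          gcongr
          exact le_abs_self c
      _ = ‖L‖ * (|c| * 2 ^ m) * (‖x‖ ^ m)⁻¹ * ‖w (x - t)‖ := by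
          rw [div_pow, inv_div]
          ring
  have h := norm_integral_le_of_norm_le ((hw.norm.comp_sub_left x).const_mul _)
    (ae_of_all _ norm_integrand_le)
  rw [integral_const_mul, integral_sub_left_eq_self (fun y => ‖w y‖) μ x] at h
  rw [norm_inv, norm_pow, norm_norm]
  exact h.trans_eq (by ring)

end Decay

section BiotSavart

open Bornology Asymptotics

lemma locallyIntegrable_inv_norm_pow {E : Type*} [NormedAddCommGroup E] [NormedSpace ℝ E]
    [FiniteDimensional ℝ E] [MeasurableSpace E] [BorelSpace E] {μ : Measure E}
    [μ.IsAddHaarMeasure] {m : ℕ} (hm : m < Module.finrank ℝ E) :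
    LocallyIntegrable (fun z : E => (‖z‖ ^ m)⁻¹) μ :=
  locallyIntegrable_of_norm_le_rpow (C := 1) (α := m) (by omega) (by exact_mod_cast hm)
    (ae_of_all _ fun z => by simp [Real.rpow_neg]) (by fun_prop)

lemma memLp_two_of_isBigO_cobounded {E F : Type*} [NormedAddCommGroup E] [NormedSpace ℝ E]
    [FiniteDimensional ℝ E] [MeasurableSpace E] [BorelSpace E] {μ : Measure E}
    [μ.IsAddHaarMeasure] [NormedAddCommGroup F] {m : ℕ} (hm : Module.finrank ℝ E < 2 * m)
    {f : E → F} (hf : Continuous f) (hO : f =O[cobounded E] fun x => (‖x‖ ^ m)⁻¹) :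
    MemLp f 2 μ := by
  rw [memLp_two_iff_integrable_sq_norm hf.aestronglyMeasurable]
  rw [Metric.cobounded_eq_cocompact] at hO
  have hm' : (Module.finrank ℝ E : ℝ) < (2 * m : ℕ) := by exact_mod_cast hm
  have sq_isBigO : (fun x => ((‖x‖ ^ m)⁻¹) ^ 2) =O[cocompact E]
      fun x => (1 + ‖x‖) ^ (-(2 * m : ℕ) : ℝ) := by
    refine IsBigO.of_bound (2 ^ (2 * m)) ?_
    filter_upwards [(tendsto_norm_cocompact_atTop (E := E)).eventually_ge_atTop 1] with x hx
    rw [Real.norm_of_nonneg (by positivity), Real.norm_of_nonneg (by positivity),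
      Real.rpow_neg (by positivity), Real.rpow_natCast, inv_pow, ← pow_mul, mul_comm m,
      ← div_eq_mul_inv, ← div_pow, ← inv_pow]
    gcongr
    rw [inv_le_iff_one_le_mul₀ (by linarith), ← mul_div_right_comm, one_le_div (by positivity)]
    linarith
  exact (hf.norm.pow 2).locallyIntegrable.integrable_of_isBigO_cocompact
    ((hO.norm_left.pow 2).trans sq_isBigO) ((integrable_one_add_norm hm').integrableAtFilter _)

lemma hasFDerivAt_inv_norm {E : Type*} [NormedAddCommGroup E] [InnerProductSpace ℝ E] {z : E}
    (hz : z ≠ 0) : HasFDerivAt (fun z : E => ‖z‖⁻¹) (innerSL ℝ (-(‖z‖ ^ 3)⁻¹ • z)) z := by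
  have hz' : ‖z‖ ≠ 0 := norm_ne_zero_iff.2 hz
  have h := ((Real.hasDerivAt_sqrt (pow_ne_zero 2 hz')).inv (by positivity)).comp_hasFDerivAt z
    (hasStrictFDerivAt_norm_sq z).hasFDerivAt
  simp only [Function.comp_def, Pi.inv_apply, Real.sqrt_sq (norm_nonneg _)] at h
  refine h.congr_fderiv ?_
  ext v
  simp only [smul_apply, innerSL_apply_apply, inner_smul_left, map_neg, map_inv₀, map_pow,
    conj_trivial, smul_eq_mul, nsmul_eq_mul, Nat.cast_ofNat]
  field_simp

/-- The fundamental solution `1 / (4π|z|)` of `-Δ` on three-space. -/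
def newtonianKernel (z : E3) : ℝ := (4 * Real.pi)⁻¹ * ‖z‖⁻¹

/-- The gradient `-z / (4π|z|³)` of the Newtonian kernel. Its convolution with a vorticity, through
the cross product, is the Biot–Savart field: the minus sign is the one in `biotSavart`. -/
def biotSavartKernel (z : E3) : E3 := (4 * Real.pi)⁻¹ • -(‖z‖ ^ 3)⁻¹ • z

lemma hasFDerivAt_newtonianKernel {z : E3} (hz : z ≠ 0) :
    HasFDerivAt newtonianKernel (innerSL ℝ (biotSavartKernel z)) z := by
  rw [biotSavartKernel, map_smul]
  exact (hasFDerivAt_inv_norm hz).const_smul (4 * Real.pi)⁻¹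

lemma norm_newtonianKernel (z : E3) : ‖newtonianKernel z‖ = (4 * Real.pi)⁻¹ * (‖z‖ ^ 1)⁻¹ := by
  rw [newtonianKernel, Real.norm_of_nonneg (by positivity), pow_one]

lemma norm_biotSavartKernel (z : E3) :
    ‖biotSavartKernel z‖ = (4 * Real.pi)⁻¹ * (‖z‖ ^ 2)⁻¹ := by
  rw [biotSavartKernel, norm_smul, norm_smul, norm_neg, Real.norm_of_nonneg (by positivity),
    Real.norm_of_nonneg (by positivity)]
  rcases eq_or_ne z 0 with rfl | hz
  · simp
  · have hz' : ‖z‖ ≠ 0 := norm_ne_zero_iff.2 hz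
    field_simp

lemma locallyIntegrable_newtonianKernel : LocallyIntegrable newtonianKernel volume :=
  ((locallyIntegrable_inv_norm_pow (m := 1) (by simp)).smul (4 * Real.pi)⁻¹).mono
    (by unfold newtonianKernel; fun_prop)
    (ae_of_all _ fun z => by simp [newtonianKernel])

lemma locallyIntegrable_inv_norm_mul_newtonianKernel :
    LocallyIntegrable (fun z => ‖z‖⁻¹ * newtonianKernel z) volume :=
  ((locallyIntegrable_inv_norm_pow (m := 2) (by simp)).smul (4 * Real.pi)⁻¹).mono
    (by unfold newtonianKernel; fun_prop)
    (ae_of_all _ fun z => le_of_eq (by simp [newtonianKernel]; ring))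

lemma locallyIntegrable_biotSavartKernel : LocallyIntegrable biotSavartKernel volume :=
  ((locallyIntegrable_inv_norm_pow (m := 2) (by simp)).smul (4 * Real.pi)⁻¹).mono
    (by unfold biotSavartKernel; fun_prop)
    (ae_of_all _ fun z => le_of_eq (by simp [norm_biotSavartKernel, abs_of_pos Real.pi_pos]))

lemma locallyIntegrable_inner_biotSavartKernel (v : E3) :
    LocallyIntegrable (fun z => inner ℝ (biotSavartKernel z) v) volume :=
  (locallyIntegrable_biotSavartKernel.smul ‖v‖).mono
    (by unfold biotSavartKernel; fun_prop)
    (ae_of_all _ fun z => (norm_inner_le_norm _ v).trans_eq (by simp [norm_smul, mul_comm]))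

/-- The Newtonian potential of a vector field, a vector potential of its Biot–Savart field. -/
def vectorPotential (w : E3 → E3) : E3 → E3 :=
  newtonianKernel ⋆[ContinuousLinearMap.lsmul ℝ ℝ, volume] w

lemma biotSavart_eq_convolution (w : E3 → E3) :
    biotSavart w = biotSavartKernel ⋆[crossL, volume] w := by
  ext1 x
  rw [convolution_eq_swap, biotSavart, ← integral_neg]
  refine integral_congr_ae (ae_of_all _ fun y => ?_)
  have kernel_eq : biotSavartKernel (x - y) = -((1 / (4 * Real.pi * ‖x - y‖ ^ 3)) • (x - y)) := by
    rw [biotSavartKernel, smul_smul, mul_neg, neg_smul, ← mul_inv, one_div]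
  simp only [kernel_eq, map_neg, neg_apply, crossL_apply]

variable {w : E3 → E3}

lemma contDiff_vectorPotential {n : ℕ∞} (hw : ContDiff ℝ n w) (hc : HasCompactSupport w) :
    ContDiff ℝ n (vectorPotential w) :=
  hc.contDiff_convolution_right _ locallyIntegrable_newtonianKernel hw

lemma fderiv_vectorPotential_apply (hw : ContDiff ℝ 1 w) (hc : HasCompactSupport w) (x v : E3) :
    fderiv ℝ (vectorPotential w) x v = ∫ z, inner ℝ (biotSavartKernel z) v • w (x - z) :=
  fderiv_convolution_of_singularity (fun _ => hasFDerivAt_newtonianKernel)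
    locallyIntegrable_inv_norm_mul_newtonianKernel (locallyIntegrable_inner_biotSavartKernel v)
    hw hc x

theorem curl_vectorPotential (hw : ContDiff ℝ 1 w) (hc : HasCompactSupport w) :
    curl (vectorPotential w) = biotSavart w := by
  ext1 x
  have integrable_kernel (v : E3) :
      Integrable fun z => inner ℝ (biotSavartKernel z) v • w (x - z) :=
    (locallyIntegrable_inner_biotSavartKernel v).integrable_smul_right_of_hasCompactSupport
      (hw.continuous.comp (by fun_prop)) (hc.comp_homeomorph (Homeomorph.subLeft x))
  rw [biotSavart_eq_convolution, convolution_def]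
  simp only [curl, fderiv_vectorPotential_apply hw hc,
    ← ContinuousLinearMap.integral_comp_comm _ (integrable_kernel _)]
  rw [← integral_finsetSum _ fun i _ => (crossL _).integrable_comp (integrable_kernel _)]
  simp only [map_smul, sum_inner_single_smul_crossL]

lemma isBigO_vectorPotential (hw : Continuous w) (hc : HasCompactSupport w) :
    vectorPotential w =O[cobounded E3] fun x => ‖x‖⁻¹ := by
  simpa only [pow_one] using! isBigO_cobounded_convolution _
    (fun z => (norm_newtonianKernel z).le) (hw.integrable_of_hasCompactSupport hc)
    (hc.isBounded.subset (subset_tsupport w))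

lemma isBigO_biotSavart (hw : Continuous w) (hc : HasCompactSupport w) :
    biotSavart w =O[cobounded E3] fun x => (‖x‖ ^ 2)⁻¹ := by
  rw [biotSavart_eq_convolution]
  exact isBigO_cobounded_convolution _ (fun z => (norm_biotSavartKernel z).le)
    (hw.integrable_of_hasCompactSupport hc) (hc.isBounded.subset (subset_tsupport w))

theorem memLp_biotSavart (hw : Continuous w) (hc : HasCompactSupport w) :
    MemLp (biotSavart w) 2 volume := by
  refine memLp_two_of_isBigO_cobounded (by simp) ?_ (isBigO_biotSavart hw hc)
  rw [biotSavart_eq_convolution]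
  exact hc.continuous_convolution_right _ locallyIntegrable_biotSavartKernel hw

end BiotSavart

section WeakClosure

variable {α F : Type*} [MeasurableSpace α] {μ : Measure α} [NormedAddCommGroup F]

lemma tendsto_eLpNorm_indicator_zero {p : ℝ≥0∞} (hp0 : p ≠ 0) (hp : p ≠ ⊤) {g : α → F}
    (hg : MemLp g p μ) {s : ℕ → Set α} (hs : ∀ n, MeasurableSet (s n))
    (h0 : ∀ᵐ x ∂μ, ∀ᶠ n in atTop, x ∉ s n) :
    Tendsto (fun n => eLpNorm ((s n).indicator g) p μ) atTop (𝓝 0) := by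
  have hp' : 0 < p.toReal := ENNReal.toReal_pos hp0 hp
  simp only [eLpNorm_eq_lintegral_rpow_enorm_toReal hp0 hp]
  have tendsto_lintegral := tendsto_lintegral_of_dominated_convergence' (μ := μ) (f := fun _ => 0)
    (F := fun n x => ‖(s n).indicator g x‖ₑ ^ p.toReal) (fun x => ‖g x‖ₑ ^ p.toReal)
    (fun n => (hg.1.indicator (hs n)).enorm.pow_const _)
    (fun n => ae_of_all _ fun x => by
      dsimp only
      gcongr
      exact enorm_indicator_le_enorm_self g x)
    (lintegral_rpow_enorm_lt_top_of_eLpNorm_lt_top hp0 hp hg.2).ne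
    (h0.mono fun x hx => tendsto_const_nhds.congr' <| hx.mono fun n hn => by
      dsimp only
      rw [indicator_of_notMem hn, enorm_zero, ENNReal.zero_rpow_of_pos hp'])
  rw [lintegral_zero] at tendsto_lintegral
  simpa only [ENNReal.zero_rpow_of_pos (one_div_pos.2 hp')] using
    tendsto_lintegral.ennrpow_const (1 / p.toReal)

variable [InnerProductSpace ℝ F]

lemma inner_toLp_indicator_support (g u : Lp F 2 μ)
    (hg : MemLp ((Function.support u).indicator g) 2 μ) :
    inner ℝ (hg.toLp _) u = inner ℝ g u := by
  rw [L2.inner_def, L2.inner_def]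
  refine integral_congr_ae ?_
  filter_upwards [hg.coeFn_toLp] with x hx
  rw [hx]
  rcases eq_or_ne (u x) 0 with h | h
  · rw [h, inner_zero_right, inner_zero_right]
  · rw [indicator_of_mem h]

lemma tendsto_inner_zero_of_ae_eventually_eq_zero (g : Lp F 2 μ) {u : ℕ → Lp F 2 μ} {Q : ℝ}
    (hQ : ∀ n, ‖u n‖ ≤ Q) (h0 : ∀ᵐ x ∂μ, ∀ᶠ n in atTop, u n x = 0) :
    Tendsto (fun n => inner ℝ g (u n)) atTop (𝓝 0) := by
  have hs : ∀ n, MeasurableSet (Function.support (u n)) := fun n =>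
    (Lp.stronglyMeasurable (u n)).measurableSet_support
  have hG : ∀ n, MemLp ((Function.support (u n)).indicator g) 2 μ := fun n =>
    (Lp.memLp g).indicator (hs n)
  have tendsto_norm : Tendsto (fun n => ‖(hG n).toLp‖ * Q) atTop (𝓝 0) := by
    have tendsto_eLpNorm := tendsto_eLpNorm_indicator_zero (by simp) (by simp) (Lp.memLp g) hs
      (h0.mono fun x hx => hx.mono fun n => Function.notMem_support.2)
    simpa only [Lp.norm_toLp, ENNReal.toReal_zero, zero_mul, Function.comp_def] using
      ((ENNReal.tendsto_toReal ENNReal.zero_ne_top).comp tendsto_eLpNorm).mul_const Q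
  refine squeeze_zero_norm (fun n => ?_) tendsto_norm
  rw [← inner_toLp_indicator_support g (u n) (hG n)]
  exact (norm_inner_le_norm _ _).trans (mul_le_mul_of_nonneg_left (hQ n) (norm_nonneg _))

lemma mem_topologicalClosure_of_ae_eventually_eq [CompleteSpace F] (S : Submodule ℝ (Lp F 2 μ))
    {u : ℕ → Lp F 2 μ} {f : Lp F 2 μ} {Q : ℝ} (hu : ∀ n, u n ∈ S) (hQ : ∀ n, ‖u n‖ ≤ Q)
    (h : ∀ᵐ x ∂μ, ∀ᶠ n in atTop, u n x = f x) : f ∈ S.topologicalClosure := by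
  rw [← Submodule.orthogonal_orthogonal_eq_closure, Submodule.mem_orthogonal]
  intro g hg
  have inner_eq : ∀ n, inner ℝ g (u n - f) = -inner ℝ g f := fun n => by
    rw [inner_sub_right, (Submodule.mem_orthogonal' _ g).1 hg _ (hu n), zero_sub]
  have tendsto_inner : Tendsto (fun n => inner ℝ g (u n - f)) atTop (𝓝 0) := by
    refine tendsto_inner_zero_of_ae_eventually_eq_zero g (Q := Q + ‖f‖)
      (fun n => (norm_sub_le _ _).trans (by gcongr; exact hQ n)) ?_
    filter_upwards [h, ae_all_iff.2 fun n => Lp.coeFn_sub (u n) f] with x hx hsub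
    filter_upwards [hx] with n hn
    rw [hsub n, Pi.sub_apply, hn, sub_self]
  simp only [inner_eq] at tendsto_inner
  exact neg_eq_zero.1 (tendsto_nhds_unique tendsto_const_nhds tendsto_inner)

end WeakClosure

section ThinSet

/-- A set is thin if its tubular neighbourhoods have volume `O(r ^ 2)` in their radius `r`, that
is, if its upper Minkowski content of codimension two is finite. -/
def IsThin (C : Set E3) : Prop :=
  ∃ D : NNReal, ∀ᶠ r in 𝓝[>] 0, volume (Metric.thickening r C) ≤ D * ENNReal.ofReal r ^ 2

lemma IsThin.volume_eq_zero {C : Set E3} (hC : IsThin C) : volume C = 0 := by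
  obtain ⟨D, hD⟩ := hC
  have tendsto_zero : Tendsto (fun r => (D : ℝ≥0∞) * ENNReal.ofReal r ^ 2) (𝓝[>] 0) (𝓝 0) := by
    have : Continuous fun r => (D : ℝ≥0∞) * ENNReal.ofReal r ^ 2 :=
      (ENNReal.continuous_const_mul ENNReal.coe_ne_top).comp
        ((ENNReal.continuous_pow 2).comp ENNReal.continuous_ofReal)
    simpa using (this.tendsto 0).mono_left nhdsWithin_le_nhds
  refine le_antisymm (ge_of_tendsto tendsto_zero ?_) zero_le
  filter_upwards [hD, self_mem_nhdsWithin] with r hr hr0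
  exact (measure_mono (Metric.self_subset_thickening hr0 C)).trans hr

lemma thickening_image_Icc_subset_iUnion_ball {X : Type*} [PseudoMetricSpace X] {a b r : ℝ}
    (hr : 0 < r) {γ : ℝ → X} {L : NNReal} (hγ : LipschitzOnWith L γ (Icc a b)) :
    Metric.thickening r (γ '' Icc a b) ⊆
      ⋃ i ∈ Finset.range (⌊(b - a) / r⌋₊ + 1), Metric.ball (γ (a + i * r)) ((L + 1) * r) := by
  intro x hx
  obtain ⟨_, ⟨t, ht, rfl⟩, hxt⟩ := Metric.mem_thickening_iff.1 hx
  set i := ⌊(t - a) / r⌋₊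
  have floor_le : i * r ≤ t - a := by
    rw [← le_div_iff₀ hr]
    exact Nat.floor_le (div_nonneg (by linarith [ht.1]) hr.le)
  have lt_floor : t - a < (i + 1) * r := by
    rw [← div_lt_iff₀ hr]
    exact Nat.lt_floor_add_one _
  have node_mem : a + i * r ∈ Icc a b :=
    ⟨le_add_of_nonneg_right (by positivity), by linarith [ht.2]⟩
  have dist_node_le : dist t (a + i * r) ≤ r := by
    rw [Real.dist_eq, abs_le]
    constructor <;> linarith
  simp only [mem_iUnion, Finset.mem_range, Metric.mem_ball]
  refine ⟨i, Nat.lt_succ_of_le (Nat.floor_le_floor (by gcongr; exact ht.2)), ?_⟩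
  calc dist x (γ (a + i * r)) ≤ dist x (γ t) + dist (γ t) (γ (a + i * r)) := dist_triangle _ _ _
    _ < r + L * r := add_lt_add_of_lt_of_le hxt
        ((hγ.dist_le_mul t ht _ node_mem).trans (by gcongr))
    _ = (L + 1) * r := by ring

lemma isThin_image_Icc {a b : ℝ} (hab : a ≤ b) {γ : ℝ → E3} {L : NNReal}
    (hγ : LipschitzOnWith L γ (Icc a b)) : IsThin (γ '' Icc a b) := by
  set V : NNReal := (volume (Metric.ball (0 : E3) 1)).toNNReal
  refine ⟨(b - a + 1).toNNReal * (L + 1) ^ 3 * V, ?_⟩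
  filter_upwards [Ioc_mem_nhdsGT one_pos] with r ⟨hr, hr1⟩
  set N := ⌊(b - a) / r⌋₊ + 1
  have volume_ball (i : ℕ) : volume (Metric.ball (γ (a + i * r)) ((L + 1) * r)) =
      ((L + 1) * ENNReal.ofReal r) ^ 3 * V := by
    rw [Measure.addHaar_ball volume _ (by positivity), finrank_euclideanSpace_fin,
      ENNReal.ofReal_pow (by positivity), ENNReal.ofReal_mul (by positivity),
      ENNReal.coe_toNNReal measure_ball_lt_top.ne, ENNReal.ofReal_add (by positivity) zero_le_one,
      ENNReal.ofReal_coe_nnreal, ENNReal.ofReal_one]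
  have count_mul_le : (N : ℝ≥0∞) * ENNReal.ofReal r ≤ ENNReal.ofReal (b - a + 1) := by
    rw [← ENNReal.ofReal_natCast, ← ENNReal.ofReal_mul (by positivity)]
    refine ENNReal.ofReal_le_ofReal ?_
    have floor_mul_le : ⌊(b - a) / r⌋₊ * r ≤ b - a := by
      rw [← le_div_iff₀ hr]
      exact Nat.floor_le (div_nonneg (by linarith) hr.le)
    push_cast [N]
    linarith
  calc volume (Metric.thickening r (γ '' Icc a b))
      ≤ ∑ i ∈ Finset.range N, volume (Metric.ball (γ (a + i * r)) ((L + 1) * r)) :=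
        (measure_mono (thickening_image_Icc_subset_iUnion_ball hr hγ)).trans
          (measure_biUnion_finset_le _ _)
    _ = (N * ENNReal.ofReal r) * (L + 1) ^ 3 * V * ENNReal.ofReal r ^ 2 := by
        simp only [volume_ball, Finset.sum_const, Finset.card_range, nsmul_eq_mul]
        ring
    _ ≤ ENNReal.ofReal (b - a + 1) * (L + 1) ^ 3 * V * ENNReal.ofReal r ^ 2 := by gcongr
    _ = _ := by push_cast [ENNReal.ofReal]; rfl

lemma IsInjectiveC2Curve.isCompact {C : Set E3} (hC : IsInjectiveC2Curve C) : IsCompact C := by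
  obtain ⟨a, b, γ, -, hγ, -, -, rfl⟩ := hC
  exact isCompact_Icc.image_of_continuousOn hγ.continuousOn

lemma IsInjectiveC2Curve.nonempty {C : Set E3} (hC : IsInjectiveC2Curve C) : C.Nonempty := by
  obtain ⟨a, b, γ, hab, -, -, -, rfl⟩ := hC
  exact (nonempty_Icc.2 hab.le).image γ

lemma IsInjectiveC2Curve.isThin {C : Set E3} (hC : IsInjectiveC2Curve C) : IsThin C := by
  obtain ⟨a, b, γ, hab, hγ, -, -, rfl⟩ := hC
  obtain ⟨L, hL⟩ := hγ.exists_lipschitzOnWith (by simp) (convex_Icc a b) isCompact_Icc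
  exact isThin_image_Icc hab.le hL

end ThinSet

section CurlCutoff

lemma eLpNorm_two_le_of_measure_le {α F : Type*} [MeasurableSpace α] {μ : Measure α}
    [NormedAddCommGroup F] {f : α → F} {s : Set α} {D : ℝ≥0∞} {c ρ : ℝ} (hρ : 0 < ρ)
    (hs : μ s ≤ D * ENNReal.ofReal ρ ^ 2) (hf0 : ∀ x ∉ s, f x = 0)
    (hf : ∀ x ∈ s, ‖f x‖ ≤ c / ρ) :
    eLpNorm f 2 μ ≤ D ^ (1 / 2 : ℝ) * ENNReal.ofReal c := by
  have enorm_le : ∀ x, ‖f x‖ₑ ≤ ‖s.indicator (fun _ => ENNReal.ofReal (c / ρ)) x‖ₑ := fun x => by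
    by_cases hx : x ∈ s
    · rw [indicator_of_mem hx, enorm_eq_self, ← ofReal_norm]
      exact ENNReal.ofReal_le_ofReal (hf x hx)
    · rw [hf0 x hx, enorm_zero]
      exact zero_le
  calc eLpNorm f 2 μ
      ≤ ENNReal.ofReal (c / ρ) * μ s ^ (1 / 2 : ℝ) :=
        (eLpNorm_mono_enorm enorm_le).trans (eLpNorm_indicator_const_le _ _)
    _ ≤ ENNReal.ofReal (c / ρ) * (D * ENNReal.ofReal ρ ^ 2) ^ (1 / 2 : ℝ) := by gcongr
    _ = D ^ (1 / 2 : ℝ) * (ENNReal.ofReal (c / ρ) * ENNReal.ofReal ρ) := by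
        rw [ENNReal.mul_rpow_of_nonneg _ _ (by norm_num), ← ENNReal.rpow_natCast_mul]
        norm_num
        ring
    _ = D ^ (1 / 2 : ℝ) * ENNReal.ofReal c := by
        rw [← ENNReal.ofReal_mul' hρ.le, div_mul_cancel₀ _ hρ.ne']

lemma eLpNorm_curl_smul_le {θ : E3 → ℝ} {ψ : E3 → E3} (hθ : Differentiable ℝ θ)
    (hθ1 : ∀ x, ‖θ x‖ ≤ 1) (hψ : Differentiable ℝ ψ) :
    eLpNorm (curl fun x => θ x • ψ x) 2 volume ≤ eLpNorm (curl ψ) 2 volume +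
      ENNReal.ofReal ‖crossL‖ * eLpNorm (fun x => ‖fderiv ℝ θ x‖ * ‖ψ x‖) 2 volume := by
  have measurable_curl : Measurable (curl ψ) :=
    Finset.measurable_fun_sum _ fun i _ =>
      (crossL _).measurable.comp (measurable_fderiv_apply_const ℝ ψ _)
  have measurable_energy : Measurable fun x => ‖fderiv ℝ θ x‖ * ‖ψ x‖ :=
    (measurable_fderiv ℝ θ).norm.mul hψ.continuous.norm.measurable
  have norm_curl_smul_le : ∀ x, ‖curl (fun y => θ y • ψ y) x‖ ≤
      ‖curl ψ x‖ + ‖crossL‖ * (‖fderiv ℝ θ x‖ * ‖ψ x‖) := fun x => by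
    rw [curl_smul (hθ x) (hψ x), ← norm_gradient, ← mul_assoc]
    refine (norm_add_le _ _).trans (add_le_add ?_ (crossL.le_opNorm₂ _ _))
    rw [norm_smul]
    exact mul_le_of_le_one_left (norm_nonneg _) (hθ1 x)
  refine (eLpNorm_mono_real norm_curl_smul_le).trans ((eLpNorm_add_le
    measurable_curl.norm.aestronglyMeasurable
    (measurable_energy.const_mul _).aestronglyMeasurable (by norm_num)).trans_eq ?_)
  rw [eLpNorm_norm, ← Real.enorm_of_nonneg (norm_nonneg crossL), ← eLpNorm_const_smul]
  rfl

lemma IsTestField.memLp {Ω : Set E3} {φ : E3 → E3} (hφ : IsTestField Ω φ) (p : ℝ≥0∞) :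
    MemLp φ p volume :=
  hφ.contDiff.continuous.memLp_of_hasCompactSupport hφ.hasCompactSupport

lemma IsTestField.restrictL2_mem_solenoidal {Ω : Set E3} {φ : E3 → E3} (hφ : IsTestField Ω φ) :
    restrictL2 Ω (hφ.memLp 2) ∈ solenoidal Ω :=
  (testFieldsL2 Ω).le_topologicalClosure ⟨φ, hφ, MemLp.coeFn_toLp _⟩

variable {ι : Type*} {l : Filter ι} [l.NeBot] [l.IsCountablyGenerated] {Ω : Set E3} {Q : ℝ≥0∞}

lemma restrictL2_mem_solenoidal_of_eventually_eq (hΩ : MeasurableSet Ω) {u : ι → E3 → E3}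
    {f : E3 → E3} (hf : MemLp f 2 volume) (hQ : Q ≠ ⊤)
    (hu : ∀ᶠ i in l, ∃ h : MemLp (u i) 2 volume, restrictL2 Ω h ∈ solenoidal Ω)
    (hbound : ∀ᶠ i in l, eLpNorm (u i) 2 volume ≤ Q)
    (hlim : ∀ x ∈ Ω, ∀ᶠ i in l, u i x = f x) : restrictL2 Ω hf ∈ solenoidal Ω := by
  obtain ⟨i, tendsto_i, h⟩ := exists_seq_forall_of_frequently (hu.and hbound).frequently
  choose memLp_u mem_solenoidal using fun n => (h n).1
  have closure_eq : (solenoidal Ω).topologicalClosure = solenoidal Ω :=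
    (testFieldsL2 Ω).isClosed_topologicalClosure.submodule_topologicalClosure_eq
  rw [← closure_eq]
  refine mem_topologicalClosure_of_ae_eventually_eq (Q := Q.toReal) _ mem_solenoidal
    (fun n => ?_) ?_
  · rw [restrictL2, Lp.norm_toLp]
    exact ENNReal.toReal_mono hQ ((eLpNorm_restrict_le _ _ _ _).trans (h n).2)
  · filter_upwards [ae_restrict_mem hΩ, (hf.restrict Ω).coeFn_toLp,
      ae_all_iff.2 fun n => ((memLp_u n).restrict Ω).coeFn_toLp] with x hx coe_f coe_u
    filter_upwards [tendsto_i.eventually (hlim x hx)] with n hn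
    rw [restrictL2, restrictL2, coe_f, coe_u, hn]

lemma restrictL2_curl_mem_solenoidal_of_cutoff (hΩ : MeasurableSet Ω) {θ : ι → E3 → ℝ}
    {ψ : E3 → E3} (hψ : Differentiable ℝ ψ) (hv : MemLp (curl ψ) 2 volume) (hQ : Q ≠ ⊤)
    (hθ : ∀ᶠ i in l, Differentiable ℝ (θ i)) (hθ1 : ∀ᶠ i in l, ∀ x, ‖θ i x‖ ≤ 1)
    (henergy : ∀ᶠ i in l, eLpNorm (fun x => ‖fderiv ℝ (θ i) x‖ * ‖ψ x‖) 2 volume ≤ Q)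
    (hlim : ∀ x ∈ Ω, ∀ᶠ i in l, θ i x = 1 ∧ fderiv ℝ (θ i) x = 0)
    (hmem : ∀ᶠ i in l, ∃ h : MemLp (curl fun x => θ i x • ψ x) 2 volume,
      restrictL2 Ω h ∈ solenoidal Ω) :
    restrictL2 Ω hv ∈ solenoidal Ω := by
  refine restrictL2_mem_solenoidal_of_eventually_eq hΩ hv
    (Q := eLpNorm (curl ψ) 2 volume + ENNReal.ofReal ‖crossL‖ * Q)
    (ENNReal.add_ne_top.2 ⟨hv.eLpNorm_ne_top, ENNReal.mul_ne_top ENNReal.ofReal_ne_top hQ⟩)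
    hmem ?_ ?_
  · filter_upwards [hθ, hθ1, henergy] with i hi hi1 hiQ
    refine (eLpNorm_curl_smul_le hi hi1 hψ).trans ?_
    gcongr
  · intro x hx
    filter_upwards [hθ, hlim x hx] with i hi h
    rw [curl_smul (hi x) (hψ x), h.1, gradient, h.2, map_zero, map_zero, zero_apply, one_smul,
      add_zero]

end CurlCutoff

section Removability

open Bornology Asymptotics

variable {C : Set E3} {ψ : E3 → E3} {M B r : ℝ} {η : E3 → ℝ}

lemma tendsto_three_mul_nhdsGT_zero : Tendsto (fun r : ℝ => 3 * r) (𝓝[>] 0) (𝓝[>] 0) :=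
  tendsto_nhdsWithin_iff.2 ⟨((continuous_const_mul 3).tendsto' 0 0 (mul_zero 3)).mono_left
    nhdsWithin_le_nhds, eventually_mem_nhdsWithin.mono fun _ hr => mem_Ioi.2 (mul_pos three_pos hr)⟩

lemma IsCutoff.eLpNorm_fderiv_mul_le (hη : IsCutoff C r M η) (hr : 0 < r) (hM : 0 ≤ M)
    {D : ℝ≥0∞} (hD : volume (Metric.thickening (3 * r) C) ≤ D * ENNReal.ofReal (3 * r) ^ 2)
    (hB : ∀ x, ‖ψ x‖ ≤ B) :
    eLpNorm (fun x => ‖fderiv ℝ (fun y => 1 - η y) x‖ * ‖ψ x‖) 2 volume ≤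
      D ^ (1 / 2 : ℝ) * ENNReal.ofReal (3 * (M * B)) := by
  simp only [fderiv_const_sub, norm_neg]
  refine eLpNorm_two_le_of_measure_le (by positivity) hD (fun x hx => ?_) fun x _ => ?_
  · rw [hη.fderiv_eq_zero_of_notMem hx, norm_zero, zero_mul]
  · rw [mul_div_mul_left _ _ three_ne_zero, mul_div_right_comm, norm_mul, norm_norm, norm_norm]
    gcongr
    exacts [hη.norm_fderiv_le x, hB x]

lemma restrictL2_curl_mem_solenoidal_of_hasCompactSupport (hC : IsClosed C) (hthin : IsThin C)
    (hψ : ContDiff ℝ ∞ ψ) (hc : HasCompactSupport ψ) (hv : MemLp (curl ψ) 2 volume) :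
    restrictL2 Cᶜ hv ∈ solenoidal Cᶜ := by
  obtain ⟨M, hM, exists_cutoff⟩ := exists_isCutoff E3
  obtain ⟨D, hD⟩ := hthin
  obtain ⟨B, hB⟩ := hc.exists_bound_of_continuous hψ.continuous
  choose! η hη using fun r (hr : 0 < r) => exists_cutoff C hr
  have eventually_pos : ∀ᶠ r : ℝ in 𝓝[>] 0, 0 < r := self_mem_nhdsWithin
  refine restrictL2_curl_mem_solenoidal_of_cutoff (l := 𝓝[>] (0 : ℝ))
    (θ := fun r x => 1 - η r x) (Q := D ^ (1 / 2 : ℝ) * ENNReal.ofReal (3 * (M * B)))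
    hC.measurableSet.compl (hψ.differentiable (by simp)) hv (by finiteness) ?_ ?_ ?_ ?_ ?_
  · filter_upwards [eventually_pos] with r hr
    exact ((hη r hr).contDiff.differentiable (by simp)).const_sub 1
  · filter_upwards [eventually_pos] with r hr x
    rw [Real.norm_of_nonneg (sub_nonneg.2 ((hη r hr).le_one x))]
    exact sub_le_self 1 ((hη r hr).nonneg x)
  · filter_upwards [eventually_pos, tendsto_three_mul_nhdsGT_zero.eventually hD] with r hr hrD
    exact (hη r hr).eLpNorm_fderiv_mul_le hr hM hrD hB
  · intro x hx
    have eventually_notMem := Metric.eventually_notMem_thickening_of_infEDist_pos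
      (hC.closure_eq.symm ▸ hx)
    filter_upwards [eventually_pos, tendsto_three_mul_nhdsGT_zero.eventually
      (eventually_notMem.filter_mono nhdsWithin_le_nhds)] with r hr hrx
    rw [fderiv_const_sub, (hη r hr).fderiv_eq_zero_of_notMem hrx,
      (hη r hr).eq_zero_of_notMem x hrx, sub_zero, neg_zero]
    exact ⟨rfl, rfl⟩
  · filter_upwards [eventually_pos] with r hr
    have tsupport_subset : tsupport (fun x => (1 - η r x) • ψ x) ⊆ Cᶜ :=
      (tsupport_smul_subset_left (fun x => 1 - η r x) ψ).trans
        ((hη r hr).tsupport_one_sub_subset.trans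
          (compl_subset_compl.2 (Metric.self_subset_thickening hr C)))
    have isTestField := isTestField_curl ((contDiff_const.sub (hη r hr).contDiff).smul hψ)
      (HasCompactSupport.smul_left (f := fun x => 1 - η r x) hc) tsupport_subset
    exact ⟨isTestField.memLp 2, isTestField.restrictL2_mem_solenoidal⟩

lemma IsCutoff.eLpNorm_fderiv_mul_le_of_le_div_norm (hη : IsCutoff {0} r M η) (hr : 1 ≤ r)
    (hM : 0 ≤ M) (hB0 : 0 ≤ B) (hB : ∀ x, r ≤ ‖x‖ → ‖ψ x‖ ≤ B / r) :
    eLpNorm (fun x => ‖fderiv ℝ η x‖ * ‖ψ x‖) 2 volume ≤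
      volume (Metric.ball (0 : E3) 1) ^ (1 / 2 : ℝ) * ENNReal.ofReal (3 ^ 2 * (M * B)) := by
  refine eLpNorm_two_le_of_measure_le (s := Metric.ball 0 (3 * r)) (ρ := (3 * r) ^ 2)
    (by positivity) ?_ (fun x hx => ?_) fun x _ => ?_
  · rw [Measure.addHaar_ball volume _ (by positivity), finrank_euclideanSpace_fin, mul_comm,
      ← ENNReal.ofReal_pow (by positivity), ← pow_mul]
    gcongr
    · linarith
    · norm_num
  · rw [← Metric.thickening_singleton] at hx
    rw [hη.fderiv_eq_zero_of_notMem hx, norm_zero, zero_mul]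
  · rw [norm_mul, norm_norm, norm_norm]
    by_cases hx : x ∈ Metric.ball 0 r
    · rw [← Metric.thickening_singleton] at hx
      rw [hη.fderiv_eq_zero_of_mem hx, norm_zero, zero_mul]
      positivity
    · have hrx : r ≤ ‖x‖ := by rwa [mem_ball_zero_iff, not_lt] at hx
      calc ‖fderiv ℝ η x‖ * ‖ψ x‖ ≤ M / r * (B / r) := by
            gcongr
            exacts [hη.norm_fderiv_le x, hB x hrx]
        _ = 3 ^ 2 * (M * B) / (3 * r) ^ 2 := by field_simp

theorem restrictL2_curl_mem_solenoidal (hC : IsClosed C) (hthin : IsThin C)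
    (hψ : ContDiff ℝ ∞ ψ) (hO : ψ =O[cobounded E3] fun x => ‖x‖⁻¹)
    (hv : MemLp (curl ψ) 2 volume) : restrictL2 Cᶜ hv ∈ solenoidal Cᶜ := by
  obtain ⟨M, hM, exists_cutoff⟩ := exists_isCutoff E3
  obtain ⟨B, hB0, hB⟩ := hO.exists_nonneg
  obtain ⟨R, -, hR⟩ := (hasBasis_cobounded_norm (E := E3)).eventually_iff.1 hB.bound
  choose! η hη using fun r (hr : 0 < r) => exists_cutoff {0} hr
  have eventually_pos : ∀ᶠ r : ℝ in atTop, 0 < r := eventually_gt_atTop 0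
  refine restrictL2_curl_mem_solenoidal_of_cutoff (l := (atTop : Filter ℝ)) (θ := η)
    (Q := volume (Metric.ball (0 : E3) 1) ^ (1 / 2 : ℝ) * ENNReal.ofReal (3 ^ 2 * (M * B)))
    hC.measurableSet.compl (hψ.differentiable (by simp)) hv (by finiteness) ?_ ?_ ?_ ?_ ?_
  · filter_upwards [eventually_pos] with r hr
    exact (hη r hr).contDiff.differentiable (by simp)
  · filter_upwards [eventually_pos] with r hr x
    rw [Real.norm_of_nonneg ((hη r hr).nonneg x)]
    exact (hη r hr).le_one x
  · filter_upwards [eventually_ge_atTop 1, eventually_ge_atTop R] with r hr hrR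
    have hr0 : 0 < r := one_pos.trans_le hr
    refine (hη r hr0).eLpNorm_fderiv_mul_le_of_le_div_norm hr hM hB0 fun x hx => ?_
    refine (hR (mem_ofPred.2 (hrR.trans hx))).trans ?_
    rw [norm_inv, norm_norm, ← div_eq_mul_inv]
    gcongr
  · intro x _
    filter_upwards [eventually_gt_atTop ‖x‖] with r hr
    have hx : x ∈ Metric.thickening r {0} := by
      rwa [Metric.thickening_singleton, mem_ball_zero_iff]
    have hr0 : 0 < r := (norm_nonneg x).trans_lt hr
    exact ⟨(hη r hr0).eq_one_of_mem x hx, (hη r hr0).fderiv_eq_zero_of_mem hx⟩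
  · filter_upwards [eventually_pos] with r hr
    have contDiff_cut : ContDiff ℝ ∞ fun x => η r x • ψ x := (hη r hr).contDiff.smul hψ
    have hasCompactSupport_cut : HasCompactSupport fun x => η r x • ψ x :=
      ((hη r hr).hasCompactSupport isBounded_singleton).smul_right
    have memLp_cut := (isTestField_curl (Ω := univ) contDiff_cut hasCompactSupport_cut
      (subset_univ _)).memLp 2
    exact ⟨memLp_cut, restrictL2_curl_mem_solenoidal_of_hasCompactSupport hC hthin contDiff_cut
      hasCompactSupport_cut memLp_cut⟩

end Removability

section LerayApproximation

variable {v φ : E3 → E3} {Ω C : Set E3}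

lemma eLpNorm_le_eLpNorm_of_restrict {α F G : Type*} [MeasurableSpace α] {μ : Measure α}
    [NormedAddCommGroup F] [NormedAddCommGroup G] {f : α → F} {g : α → G} {p : ℝ≥0∞}
    (hp : p ≠ ⊤) {s : Set α} (hs : MeasurableSet s)
    (h : eLpNorm f p (μ.restrict s) ≤ eLpNorm g p (μ.restrict s))
    (h' : eLpNorm f p (μ.restrict sᶜ) ≤ eLpNorm g p (μ.restrict sᶜ)) :
    eLpNorm f p μ ≤ eLpNorm g p μ := by
  rcases eq_or_ne p 0 with rfl | hp0
  · rw [eLpNorm_exponent_zero]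
    exact zero_le
  have hp' : 0 < 1 / p.toReal := one_div_pos.2 (ENNReal.toReal_pos hp0 hp)
  simp only [eLpNorm_eq_lintegral_rpow_enorm_toReal hp0 hp, ENNReal.rpow_le_rpow_iff hp'] at *
  rw [← lintegral_add_compl _ hs, ← lintegral_add_compl (fun x => ‖g x‖ₑ ^ p.toReal) hs]
  gcongr

lemma eLpNorm_extendByZero_sub_restrict (hΩ : MeasurableSet Ω) (f : L2Field Ω)
    (hv : MemLp v 2 volume) :
    eLpNorm (extendByZero Ω f - v) 2 (volume.restrict Ω) = ‖f - restrictL2 Ω hv‖ₑ := by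
  rw [Lp.enorm_def]
  refine eLpNorm_congr_ae ?_
  filter_upwards [ae_restrict_mem hΩ, Lp.coeFn_sub f (restrictL2 Ω hv),
    (hv.restrict Ω).coeFn_toLp] with x hx coe_sub coe_v
  rw [coe_sub, Pi.sub_apply, Pi.sub_apply, extendByZero, indicator_of_mem hx, restrictL2, coe_v]

lemma enorm_restrictL2_sub_restrictL2 (Ω : Set E3) {u : E3 → E3} (hu : MemLp u 2 volume)
    (hv : MemLp v 2 volume) :
    ‖restrictL2 Ω hu - restrictL2 Ω hv‖ₑ = eLpNorm (u - v) 2 (volume.restrict Ω) :=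
  Lp.enorm_toLp ((hu.sub hv).restrict Ω)

lemma norm_lerayProjection_sub_le (f : L2Field Ω) {g : L2Field Ω} (hg : g ∈ solenoidal Ω) :
    ‖(lerayProjection Ω f : L2Field Ω) - f‖ ≤ ‖g - f‖ := by
  rw [norm_sub_rev, norm_sub_rev g]
  exact ((solenoidal Ω).starProjection_minimal f).trans_le
    (ciInf_le ⟨0, forall_mem_range.2 fun _ => norm_nonneg _⟩ (⟨g, hg⟩ : solenoidal Ω))

theorem eLpNorm_extendByZero_lerayProjection_sub_le (hΩ : MeasurableSet Ω)
    (hv : MemLp v 2 volume) (hφ : IsTestField Ω φ) :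
    eLpNorm (extendByZero Ω (lerayProjection Ω (restrictL2 Ω hv)) - v) 2 volume ≤
      eLpNorm (φ - v) 2 volume := by
  refine eLpNorm_le_eLpNorm_of_restrict (by simp) hΩ ?_ (eLpNorm_congr_ae ?_).le
  · rw [eLpNorm_extendByZero_sub_restrict hΩ _ hv, ← enorm_restrictL2_sub_restrictL2 Ω (hφ.memLp 2),
      enorm_le_iff_norm_le]
    exact norm_lerayProjection_sub_le _ hφ.restrictL2_mem_solenoidal
  · filter_upwards [ae_restrict_mem hΩ.compl] with x hx
    rw [Pi.sub_apply, Pi.sub_apply, extendByZero, indicator_of_notMem hx,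
      image_eq_zero_of_notMem_tsupport fun h => hx (hφ.tsupport_subset h)]

lemma exists_isTestField_eLpNorm_sub_lt (hC : volume C = 0) (hv : MemLp v 2 volume)
    (h : restrictL2 Cᶜ hv ∈ solenoidal Cᶜ) {ε : ℝ≥0∞} (hε : 0 < ε) :
    ∃ φ, IsTestField Cᶜ φ ∧ eLpNorm (φ - v) 2 volume < ε := by
  obtain ⟨f, ⟨φ, hφ, hfφ⟩, hf⟩ := EMetric.mem_closure_iff.1 h ε hε
  have restrict_eq : volume.restrict Cᶜ = (volume : Measure E3) :=
    Measure.restrict_eq_self_of_ae_mem (compl_mem_ae_iff.2 hC)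
  have f_eq : f = restrictL2 Cᶜ (hφ.memLp 2) := Lp.ext (hfφ.trans (MemLp.coeFn_toLp _).symm)
  refine ⟨φ, hφ, ?_⟩
  rwa [edist_comm, edist_eq_enorm_sub, f_eq, enorm_restrictL2_sub_restrictL2, restrict_eq] at hf

variable {ι : Type*} {l : Filter ι} {K : ι → Set E3}

lemma IsTestField.eventually_compl (hφ : IsTestField Cᶜ φ) (hC : IsClosed C)
    (hKC : ∀ δ > 0, ∀ᶠ i in l, K i ⊆ Metric.thickening δ C) :
    ∀ᶠ i in l, IsTestField (K i)ᶜ φ := by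
  obtain ⟨δ, hδ, disjoint_thickening⟩ := (disjoint_left.2 hφ.tsupport_subset).exists_thickenings
    hφ.hasCompactSupport hC
  filter_upwards [hKC δ hδ] with i hi
  exact { hφ with
    tsupport_subset := disjoint_left.1 <|
      disjoint_thickening.mono (Metric.self_subset_thickening hδ _) hi }

theorem tendsto_eLpNorm_extendByZero_lerayProjection_sub (hC : IsClosed C) (hC0 : volume C = 0)
    (hK : ∀ i, MeasurableSet (K i)) (hKC : ∀ δ > 0, ∀ᶠ i in l, K i ⊆ Metric.thickening δ C)
    (hv : MemLp v 2 volume) (h : restrictL2 Cᶜ hv ∈ solenoidal Cᶜ) :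
    Tendsto (fun i => eLpNorm
      (extendByZero (K i)ᶜ (lerayProjection (K i)ᶜ (restrictL2 (K i)ᶜ hv)) - v) 2 volume)
      l (𝓝 0) := by
  refine ENNReal.tendsto_nhds_zero.2 fun ε hε => ?_
  obtain ⟨φ, hφ, hφv⟩ := exists_isTestField_eLpNorm_sub_lt hC0 hv h hε
  filter_upwards [hφ.eventually_compl hC hKC] with i hi
  exact (eLpNorm_extendByZero_lerayProjection_sub_le (hK i).compl hv hi).trans hφv.le

lemma eventually_subset_thickening_of_tendsto_hausdorffDist {X : Type*} [PseudoMetricSpace X]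
    {C : Set X} (hC : Bornology.IsBounded C) (hne : C.Nonempty) {K : ι → Set X}
    (hK : ∀ i, Bornology.IsBounded (K i))
    (hlim : Tendsto (fun i => Metric.hausdorffDist (K i) C) l (𝓝 0)) {δ : ℝ} (hδ : 0 < δ) :
    ∀ᶠ i in l, K i ⊆ Metric.thickening δ C := by
  filter_upwards [hlim.eventually_lt_const hδ] with i hi x hx
  exact Metric.mem_thickening_iff.2 (Metric.exists_dist_lt_of_hausdorffDist_lt hx hi
    (Metric.hausdorffEDist_ne_top_of_nonempty_of_bounded ⟨x, hx⟩ hne (hK i) hC))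

end LerayApproximation

end ThinObstacle
end

theorem mainTheorem3_general {C : Set ThinObstacle.E3} (hC : IsClosed C)
    (hthin : ThinObstacle.IsThin C) {ι : Type*} {l : Filter ι} {K : ι → Set ThinObstacle.E3}
    (hK : ∀ i, MeasurableSet (K i)) (hKC : ∀ δ > 0, ∀ᶠ i in l, K i ⊆ Metric.thickening δ C)
    {w : ThinObstacle.E3 → ThinObstacle.E3} (hw : ContDiff ℝ ∞ w) (hc : HasCompactSupport w) :
    ∃ hv : MemLp (ThinObstacle.biotSavart w) 2 volume, Tendsto (fun i => eLpNorm
      (ThinObstacle.extendByZero (K i)ᶜ (ThinObstacle.lerayProjection (K i)ᶜ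
        (ThinObstacle.restrictL2 (K i)ᶜ hv)) - ThinObstacle.biotSavart w) 2 volume) l (𝓝 0) := by
  have hv := ThinObstacle.memLp_biotSavart hw.continuous hc
  refine ⟨hv, ThinObstacle.tendsto_eLpNorm_extendByZero_lerayProjection_sub hC
    hthin.volume_eq_zero hK hKC hv ?_⟩
  simp only [← ThinObstacle.curl_vectorPotential (hw.of_le (by simp)) hc] at hv ⊢
  exact ThinObstacle.restrictL2_curl_mem_solenoidal hC hthin
    (ThinObstacle.contDiff_vectorPotential hw hc)
    (ThinObstacle.isBigO_vectorPotential hw.continuous hc) hv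

theorem mainTheorem3 (C : Set ThinObstacle.E3) (hC : ThinObstacle.IsInjectiveC2Curve C)
    (K : ℕ → Set ThinObstacle.E3) (hK : ∀ n, ThinObstacle.IsSmoothObstacle (K n))
    (hCK : ∀ n, C ⊆ K n)
    (hlim : Tendsto (fun n => Metric.hausdorffDist (K n) C) atTop (𝓝 0))
    (ω₀ : ThinObstacle.E3 → ThinObstacle.E3) (hω₀ : ThinObstacle.IsTestField univ ω₀) :
    ∃ hv : MemLp (ThinObstacle.biotSavart ω₀) 2 volume,
      Tendsto
        (fun n => eLpNorm
          (ThinObstacle.extendByZero (K n)ᶜ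
              (ThinObstacle.lerayProjection (K n)ᶜ (ThinObstacle.restrictL2 (K n)ᶜ hv))
            - ThinObstacle.biotSavart ω₀) 2 volume)
        atTop (𝓝 0) :=
  mainTheorem3_general hC.isCompact.isClosed hC.isThin
    (fun n => (hK n).isCompact.measurableSet)
    (fun _ => ThinObstacle.eventually_subset_thickening_of_tendsto_hausdorffDist
      hC.isCompact.isBounded hC.nonempty (fun n => (hK n).isCompact.isBounded) hlim)
    hω₀.contDiff hω₀.hasCompactSupport
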